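/- \textbf{The model.} Fix $p\in(0,1]$, $\lambda>0$, $\rho>0$, and put $h=p/(1+p)$. For $n\ge 1$ consider $n$ sites arranged in a circle, numbered $0,\dots,n-1$ clockwise (``right'' means clockwise), each carrying at most one particle; the number of particles is constant, equal to $\lceil\rho n\rceil$ (that is, $\rho n$ if $\rho n$ is an integer). A site without a particle is a hole. A particle is \emph{free} if both its neighbours are holes; a \emph{cluster} is a maximal contiguous group of at least two particles, with holes on both sides; a state is \emph{ideal} if all particles are free. In each time slot all particles are updated simultaneously: a particle whose right neighbour is a particle does not move; a free particle moves one site to the right; a particle whose right neighbour is a hole and whose left neighbour is a particle moves one site to the right with probability $p$, independently of the others. \emph{A-perturbations:} if the state after this movement is ideal, then with probability $\lambda/n$ (for $n\ge\lambda$), independently of everything else, one particle chosen uniformly at random is removed and then placed into one of the holes chosen uniformly at random (the site just vacated counts as a hole). The states with at most one cluster are never left, and the process is considered on these states. \textbf{Scaled state.} For such a state let $f^n(x)=\frac1n\#\{\text{particles in the sites }1,\dots,\lfloor nx\rfloor\}$ for $x\in[0,1)$; if there is a cluster, let $\ell^n$ and $r^n$ be $1/n$ times the positions of its left-edge and right-edge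 particles, and $\tau^n=r^n-\ell^n$ (so a cluster of $m$ particles has $\tau^n=(m-1)/n$); if there is no cluster, let $\tau^n=0$ and let $\ell^n=r^n$ be frozen at the value of $\ell^n$ at the last time when a cluster existed. The scaled state $[f^n,\ell^n,r^n,\tau^n]$ lives in the product of the space of real functions on $[0,1)$ with the uniform distance, two copies of the circle $\mathbb R/\mathbb Z$, and $\mathbb R$. Write $\tau^n(\infty)$ for the value of $\tau^n$ in a stationary regime. \textbf{Flux.} A particle relocated from site $x$ to site $y$ by a perturbation is considered to travel to the right from $x$ to $y$. The flux $\phi(\rho,n)$ is $1/n$ times the expected total distance travelled by all particles in one time slot (including relocation) in a stationary regime. \textbf{Theorem.} Assume $0<\rho<h$. For each $n$ (it suffices for all large $n$) take any stationary distribution of the process. Then, as $n\to\infty$: \begin{enumerate} \item every subsequential weak limit of the stationary distributions of $[f^n,\ell^n,r^n,\tau^n]$ is concentrated on the states with $\tau=0$; \item $\tau^n(\infty)\Rightarrow 0$ in distribution; \item $\mathbb E\,\tau^n(\infty)\to 0$; \item $\phi(\rho,n)\to\rho$, i.e. the typical flux is $\phi(\rho)=\rho$. \end{enumerate} -/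

import Mathlib

open Filter Topology MeasureTheory
open scoped ENNReal UniformConvergence unitInterval

namespace TASEPH

noncomputable section

/-- A configuration on the circle of `n` sites `ZMod n`: the set of occupied sites.
Site `i + 1` is the right neighbour of `i`, and `i - 1` is its left neighbour. -/
abbrev Config (n : ℕ) := Finset (ZMod n)

section Dynamics

variable {n : ℕ} [NeZero n]

/-! ### Clusters -/

/-- Left edges of clusters: particles with a hole on the left and a particle on the right. -/
def leftEdges (S : Config n) : Finset (ZMod n) :=
  S.filter fun i => i - 1 ∉ S ∧ i + 1 ∈ S

/-- The particles that are not free, i.e. those with a particle as a neighbour. -/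
def clusterSites (S : Config n) : Finset (ZMod n) :=
  S.filter fun i => i - 1 ∈ S ∨ i + 1 ∈ S

/-- A configuration is ideal (completely sparse, absorbing) if all its particles are free. -/
def IsIdeal (S : Config n) : Prop :=
  ∀ i ∈ S, i - 1 ∉ S ∧ i + 1 ∉ S

/-- There is at most one cluster. -/
def AtMostOneCluster (S : Config n) : Prop :=
  (leftEdges S).card ≤ 1

/-! ### Normal movement of the particles in one time slot -/

/-- Free particles whose right neighbour is a hole: they move with probability one. -/
def freeParticles (S : Config n) : Finset (ZMod n) :=
  S.filter fun i => i - 1 ∉ S ∧ i + 1 ∉ S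

/-- Particles with a hole on the right and a particle on the left: each of them moves with
probability `p`, independently of the others. -/
def holdbackParticles (S : Config n) : Finset (ZMod n) :=
  S.filter fun i => i - 1 ∈ S ∧ i + 1 ∉ S

/-- The random subset of `H` that contains every element independently with probability `p`. -/
def bernoulliSubset (p : I) (H : Finset (ZMod n)) : PMF (Finset (ZMod n)) :=
  PMF.ofFinset
    (fun M => if M ⊆ H then
      ENNReal.ofReal ((p : ℝ) ^ M.card * (1 - (p : ℝ)) ^ (H.card - M.card)) else 0)
    H.powerset
    (by
      have h1 : ∀ M ∈ H.powerset, (if M ⊆ H then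
          ENNReal.ofReal ((p : ℝ) ^ M.card * (1 - (p : ℝ)) ^ (H.card - M.card)) else 0)
          = ENNReal.ofReal ((p : ℝ) ^ M.card * (1 - (p : ℝ)) ^ (H.card - M.card)) :=
        fun M hM => if_pos (Finset.mem_powerset.mp hM)
      have h2 : (0 : ℝ) ≤ 1 - p := sub_nonneg.mpr p.2.2
      rw [Finset.sum_congr rfl h1, ← ENNReal.ofReal_sum_of_nonneg
        (fun M _ => mul_nonneg (pow_nonneg p.2.1 _) (pow_nonneg h2 _)),
        Finset.sum_pow_mul_eq_add_pow]
      simp)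
    (fun M hM => if_neg fun h => hM (Finset.mem_powerset.mpr h))

/-- The law of the set of particles that move in a time slot that starts in `S`. -/
def movers (p : I) (S : Config n) : PMF (Finset (ZMod n)) :=
  (bernoulliSubset p (holdbackParticles S)).map fun M => freeParticles S ∪ M

/-- The configuration after the particles in `M` have moved one site to the right. -/
def moved (S M : Finset (ZMod n)) : Config n :=
  (S \ M) ∪ M.image (· + 1)

/-! ### A-perturbations -/

/-- The random relocation `(x, y)`: a particle `x` is picked uniformly at random and removed, and
then one of the holes `y` (among them `x` itself) is picked uniformly at random. -/
def relocation (S : Config n) (hS : S.Nonempty) : PMF (ZMod n × ZMod n) :=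
  (PMF.uniformOfFinset S hS).bind fun x =>
    (PMF.uniformOfFinset (S.erase x)ᶜ ⟨x, by simp⟩).map fun y => (x, y)

/-- The perturbation probability `lam / n`; the truncation to `[0, 1]` matters only when
`lam` is not in `[0, n]`. -/
def perturbProb (lam : ℝ) (n : ℕ) : I :=
  Set.projIcc 0 1 zero_le_one (lam / n)

/-- A coin that shows `true` with probability `q`. -/
def coin (q : I) : PMF Bool :=
  PMF.ofFintype (fun b => if b then ENNReal.ofReal q else ENNReal.ofReal (1 - (q : ℝ))) (by
    have h : (0 : ℝ) ≤ 1 - q := sub_nonneg.mpr q.2.2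
    simp [← ENNReal.ofReal_add q.2.1 h])

open Classical in
/-- The random perturbation (`none` if there is none) after the normal movement has led to `S`:
if `S` is ideal, a relocation takes place with probability `lam / n`; if `S` is not ideal
then no perturbation takes place. -/
def perturbation (lam : ℝ) (S : Config n) : PMF (Option (ZMod n × ZMod n)) :=
  if h : IsIdeal S ∧ S.Nonempty then
    (coin (perturbProb lam n)).bind fun b =>
      if b then (relocation S h.2).map some else PMF.pure none
  else PMF.pure none

/-- The result of a perturbation. -/
def applyPerturbation (S : Config n) : Option (ZMod n × ZMod n) → Config n
  | none => S
  | some (x, y) => insert y (S.erase x)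

/-- The law of everything that happens in a time slot that starts in `S`: the set of particles
that move, and the perturbation. -/
def slotLaw (p : I) (lam : ℝ) (S : Config n) :
    PMF (Finset (ZMod n) × Option (ZMod n × ZMod n)) :=
  (movers p S).bind fun M => (perturbation lam (moved S M)).map fun o => (M, o)

/-- The total distance travelled by all particles in a time slot. A relocated particle always
travels to the right, from `x` to `y`. -/
def distance (o : Finset (ZMod n) × Option (ZMod n × ZMod n)) : ℕ :=
  o.1.card + match o.2 with
    | none => 0
    | some (x, y) => (y - x).val

/-! ### The Markov chain, its stationary distributions and its flux -/

/-- The state of the process: the configuration, and the location of the left edge of the cluster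
(of the last one that existed, if there is none at present). -/
abbrev State (n : ℕ) := Config n × ZMod n

open Classical in
/-- The remembered left edge: the left edge of the present cluster, if there is one,
and otherwise the previous value. -/
def updateEdge (S : Config n) (a : ZMod n) : ZMod n :=
  if h : ∃ x, x ∈ leftEdges S then h.choose else a

/-- The transition law of TASEP-H with A-perturbations. -/
def step (p : I) (lam : ℝ) (s : State n) : PMF (State n) :=
  (slotLaw p lam s.1).map fun o =>
    (applyPerturbation (moved s.1 o.1) o.2,
      updateEdge (applyPerturbation (moved s.1 o.1) o.2) s.2)

/-- `μ` is a stationary distribution of TASEP-H with A-perturbations with `k` particles on `n`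
sites, on the states with at most one cluster. -/
structure IsStationary (p : I) (lam : ℝ) (k : ℕ) (μ : PMF (State n)) : Prop where
  card_eq : ∀ s ∈ μ.support, s.1.card = k
  atMostOneCluster : ∀ s ∈ μ.support, AtMostOneCluster s.1
  bind_step : μ.bind (step p lam) = μ

/-- The instantaneous flux in configuration `S`: the expected total distance travelled by all
particles in the next time slot, divided by the number of sites. -/
def instantFlux (p : I) (lam : ℝ) (S : Config n) : ℝ :=
  (∑ o, (slotLaw p lam S o).toReal * distance o) / n

/-- The flux: the expected instantaneous flux under `μ`. -/
def flux (p : I) (lam : ℝ) (μ : PMF (State n)) : ℝ :=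
  ∑ s, (μ s).toReal * instantFlux p lam s.1

/-! ### Scaled descriptors of a state -/

/-- The scaled length `τ = r - ℓ` of the cluster: a cluster of `m` particles has length
`(m - 1) / n`, and `τ = 0` if there is no cluster. -/
def clusterLength (S : Config n) : ℝ :=
  (((clusterSites S).card - 1 : ℕ) : ℝ) / n

/-- The scaled distribution function, normalised to vanish at `0`: `f x` is `1 / n` times the
number of particles in the sites `1, …, ⌊n x⌋`, for `x ∈ [0, 1)`. -/
def scaledCount (S : Config n) (x : ℝ) : ℝ :=
  ((S.filter fun i => 1 ≤ i.val ∧ i.val ≤ ⌊(n : ℝ) * x⌋₊).card : ℝ) / n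

end Dynamics

/-! ### The space of scaled states -/

/-- The space of the scaled states `[f, ℓ, r, τ]`: one period of `f` with the topology of uniform
convergence, the locations `ℓ` and `r` on the circle of unit length, and the length `τ`. -/
def ScaledState := (Set.Ico (0 : ℝ) 1 →ᵤ ℝ) × UnitAddCircle × UnitAddCircle × ℝ

instance : TopologicalSpace ScaledState :=
  inferInstanceAs (TopologicalSpace
    ((Set.Ico (0 : ℝ) 1 →ᵤ ℝ) × UnitAddCircle × UnitAddCircle × ℝ))

instance : MeasurableSpace ScaledState := borel ScaledState

instance : BorelSpace ScaledState := ⟨rfl⟩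

/-- The component `τ` of a scaled state. -/
def ScaledState.tau (s : ScaledState) : ℝ := s.2.2.2

section Scaling

variable {n : ℕ} [NeZero n]

/-- The scaled state `[fⁿ, ℓⁿ, rⁿ, τⁿ]` of a state, where `rⁿ = ℓⁿ + τⁿ`. -/
def scaledState (s : State n) : ScaledState :=
  (UniformFun.ofFun fun x : Set.Ico (0 : ℝ) 1 => scaledCount s.1 x,
    (((s.2.val : ℝ) / n : ℝ) : UnitAddCircle),
    (((s.2.val : ℝ) / n + clusterLength s.1 : ℝ) : UnitAddCircle),
    clusterLength s.1)

/-- The law of the scaled state `[fⁿ, ℓⁿ, rⁿ, τⁿ]` when the state has law `μ`. -/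
def scaledLaw (μ : PMF (State n)) : ProbabilityMeasure ScaledState :=
  ⟨(μ.map scaledState).toMeasure, inferInstance⟩

/-- The law of the scaled cluster length `τⁿ` when the state has law `μ`. -/
def lengthLaw (μ : PMF (State n)) : ProbabilityMeasure ℝ :=
  ⟨(μ.map fun s => clusterLength s.1).toMeasure, inferInstance⟩

/-- The mean of the scaled cluster length `τⁿ` when the state has law `μ`. -/
def meanLength (μ : PMF (State n)) : ℝ :=
  ∑ s, (μ s).toReal * clusterLength s.1

end Scaling

end

end TASEPH

/-! From each site `z`, read the configuration to the right as a walk that gains `1 - h` at a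
particle and loses `h` at a hole. Below density `h` this walk drifts down, so its exponentials are
summable (`summable_exp_height`). Seen in the frame of the free particles, a time slot changes the
walk only through held-back particles: one at the first site read lowers the heights by one, one
just beyond the end raises the height there by one (`height_moved`).

The value `h = p / (1 + p)` is critical for the height at the head of a cluster. If the head stays,
this height changes by `h`; if it leaves, the particle behind becomes the candidate and the change
is `2h - 1`. The mean is `h (1 + p) - p = 0`, so the mean of the exponential grows at most by the
factor `1 + α²` (`mean_head_displacement_le`). Meanwhile each held-back particle lowers the
logarithm of the sum based just before it by `α`, and at least half of the clustered particles are
held back. So the sum over `z` of the logarithms has drift at most `n (α² + 4ε)` minus `α / 2` per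
clustered particle (`mean_lyapunov_moved_le`).

The background weight `ε` keeps the sums away from zero. A relocation then costs at most `n (α + log
(1 + 1/ε))`, and its probability is at most `lam / n`, so its mean cost is bounded in `n`.
Stationarity cancels the Lyapunov terms. With `ε = α²`, the mean proportion of clustered sites is at
most `10 α + C(α) / n` (`IsStationary.mean_card_clusterSites_le`). Letting `n → ∞` and then `α → 0`
gives convergence to zero, from which all four claims follow. -/

set_option linter.unusedSectionVars false

namespace TASEPH

noncomputable section

/-! ### Heights along the circle and their change in one time slot -/

section Heights

variable {n : ℕ} [NeZero n]

/-- Summing over one turn around the circle is summing over all sites. -/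
theorem sum_range_natCast (f : ZMod n → ℝ) : ∑ t ∈ Finset.range n, f t = ∑ j, f j := by
  refine Finset.sum_nbij (fun t : ℕ => (t : ZMod n)) (fun _ _ => Finset.mem_univ _) ?_ ?_
    (fun _ _ => rfl)
  · intro a ha b hb hab
    have ha' : a < n := by simpa using ha
    have hb' : b < n := by simpa using hb
    have := congrArg ZMod.val hab
    simpa [ZMod.val_natCast, Nat.mod_eq_of_lt ha', Nat.mod_eq_of_lt hb'] using this
  · intro j _
    exact ⟨j.val, by simpa using ZMod.val_lt j, ZMod.natCast_zmod_val j⟩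

theorem sum_range_shift (f : ZMod n → ℝ) (z : ZMod n) :
    ∑ t ∈ Finset.range n, f (z + t + 1) = ∑ j, f j := by
  rw [sum_range_natCast fun t => f (z + t + 1)]
  refine Fintype.sum_equiv ((Equiv.addLeft z).trans (Equiv.addRight 1)) _ _ fun t => by simp

theorem sum_range_add_period (f : ZMod n → ℝ) (z : ZMod n) (i : ℕ) :
    ∑ t ∈ Finset.range (i + n), f (z + t + 1)
      = ∑ t ∈ Finset.range i, f (z + t + 1) + ∑ j, f j := by
  rw [add_comm i n, Finset.sum_range_add, sum_range_shift, add_comm]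
  simp

/-- The number of visits to `a` during `i` steps to the right from `z`. -/
def visits (z a : ZMod n) (i : ℕ) : ℝ :=
  ∑ t ∈ Finset.range i, if z + t + 1 = a then 1 else 0

theorem visits_add_period (z a : ZMod n) (i : ℕ) : visits z a (i + n) = visits z a i + 1 := by
  unfold visits
  rw [sum_range_add_period (fun j => if j = a then (1 : ℝ) else 0)]
  simp

theorem visits_nonneg (z a : ZMod n) (i : ℕ) : 0 ≤ visits z a i :=
  Finset.sum_nonneg fun t _ => by split_ifs <;> norm_num

theorem visits_le_one (z a : ZMod n) {i : ℕ} (hi : i ≤ n) : visits z a i ≤ 1 := by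
  have h : visits z a i ≤ visits z a n :=
    Finset.sum_le_sum_of_subset_of_nonneg (Finset.range_mono hi)
      fun t _ _ => by split_ifs <;> norm_num
  have h0 := visits_add_period z a 0
  simp only [zero_add] at h0
  have h1 : visits z a 0 = 0 := by simp [visits]
  linarith

/-- Every full turn visits both sites exactly once, so only an incomplete turn can make a
difference. -/
theorem visits_le_visits_add_one (z a b : ZMod n) (i : ℕ) :
    visits z a i ≤ visits z b i + 1 := by
  induction i using Nat.strong_induction_on with
  | _ i ih =>
    rcases lt_or_ge i n with hi | hi
    · linarith [visits_le_one z a hi.le, visits_nonneg z b i]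
    · have hn : 0 < n := NeZero.pos n
      have := ih (i - n) (by omega)
      rw [← Nat.sub_add_cancel hi, visits_add_period, visits_add_period]
      linarith

/-- The number of particles met during `i` steps to the right from `z`, compensated by `h` for
each step. -/
def height (h : ℝ) (S : Config n) (z : ZMod n) (i : ℕ) : ℝ :=
  ∑ t ∈ Finset.range i, ((if z + t + 1 ∈ S then 1 else 0) - h)

variable {h : ℝ} {S : Config n}

theorem height_succ (h : ℝ) (S : Config n) (z : ZMod n) (i : ℕ) :
    height h S z (i + 1) = height h S z i + ((if z + i + 1 ∈ S then 1 else 0) - h) :=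
  Finset.sum_range_succ _ _

theorem height_add_period (h : ℝ) (S : Config n) (z : ZMod n) (i : ℕ) :
    height h S z (i + n) = height h S z i + (S.card - h * n) := by
  unfold height
  rw [sum_range_add_period (fun j => (if j ∈ S then (1 : ℝ) else 0) - h)]
  simp [Finset.sum_sub_distrib, mul_comm]

theorem height_le (hh : 0 ≤ h) (z : ZMod n) (i : ℕ) : height h S z i ≤ i := by
  unfold height
  calc _ ≤ ∑ t ∈ Finset.range i, (1 : ℝ) := Finset.sum_le_sum fun t _ => by
        split_ifs <;> linarith
    _ = i := by simp

/-- Each turn lowers the height by `h * n - S.card`, which is spread evenly over its `n` steps; the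
constant term covers the first turn. -/
theorem height_le_linear (hh : 0 ≤ h) (hS : (S.card : ℝ) < h * n) (z : ZMod n) (i : ℕ) :
    height h S z i ≤ n + (h * n - S.card) - (h * n - S.card) / n * i := by
  have hn : 0 < n := NeZero.pos n
  have hn' : (0 : ℝ) < n := by exact_mod_cast hn
  induction i using Nat.strong_induction_on with
  | _ i ih =>
    rcases lt_or_ge i n with hi | hi
    · have h1 := height_le (S := S) hh z i
      have hi' : (i : ℝ) ≤ n := by exact_mod_cast hi.le
      have h2 : (h * n - S.card) / n * i ≤ (h * n - S.card) / n * n :=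
        mul_le_mul_of_nonneg_left hi' (div_nonneg (by linarith) hn'.le)
      rw [div_mul_cancel₀ _ hn'.ne'] at h2
      linarith
    · have h1 := ih (i - n) (by omega)
      have h2 : (i : ℝ) = ((i - n : ℕ) : ℝ) + n := by rw [Nat.cast_sub hi]; ring
      rw [h2, ← Nat.sub_add_cancel hi, height_add_period, Nat.sub_add_cancel hi, mul_add,
        div_mul_cancel₀ _ hn'.ne']
      linarith

theorem summable_exp_height {α : ℝ} (hα : 0 < α) (hh : 0 ≤ h) (hS : (S.card : ℝ) < h * n)
    (z : ZMod n) : Summable fun i => Real.exp (α * height h S z i) := by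
  have hn' : (0 : ℝ) < n := by exact_mod_cast NeZero.pos n
  have hc : 0 < (h * n - S.card) / n := div_pos (by linarith) hn'
  have hgeo : Summable fun i : ℕ => Real.exp (α * (n + (h * n - S.card)))
      * Real.exp (i * -(α * ((h * n - S.card) / n))) :=
    (Real.summable_exp_nat_mul_iff.mpr (by nlinarith [mul_pos hα hc])).mul_left _
  refine Summable.of_nonneg_of_le (fun i => (Real.exp_pos _).le) (fun i => ?_) hgeo
  rw [← Real.exp_add]
  refine Real.exp_le_exp.mpr ?_
  have := mul_le_mul_of_nonneg_left (height_le_linear hh hS z i) hα.le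
  linarith

/-- The height gains at most the visits to `y` and loses those to `x`. The bound does not grow with
the number of turns, although the walk goes around the circle forever. -/
theorem height_relocate_le (h : ℝ) {x : ZMod n} (hx : x ∈ S) (y z : ZMod n) (i : ℕ) :
    height h (insert y (S.erase x)) z i ≤ height h S z i + 1 := by
  have h1 : height h (insert y (S.erase x)) z i
      ≤ height h S z i + (visits z y i - visits z x i) := by
    unfold height visits
    rw [← Finset.sum_sub_distrib, ← Finset.sum_add_distrib]
    refine Finset.sum_le_sum fun t _ => ?_
    generalize z + t + 1 = j
    by_cases hy : j = y <;> by_cases hj : j = x <;> by_cases hS : j ∈ S <;>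
      simp_all
  linarith [visits_le_visits_add_one z y x i]

/-- `M` is a possible set of moving particles in a time slot that starts in `S`. -/
structure IsMove (S M : Finset (ZMod n)) : Prop where
  free_subset : freeParticles S ⊆ M
  subset : M ⊆ freeParticles S ∪ holdbackParticles S

variable {M : Finset (ZMod n)}

theorem IsMove.mem (hM : IsMove S M) {j : ZMod n} (hj : j ∈ M) : j ∈ S ∧ j + 1 ∉ S := by
  have := hM.subset hj
  simp only [freeParticles, holdbackParticles, Finset.mem_union, Finset.mem_filter] at this
  tauto

theorem mem_moved {j : ZMod n} : j ∈ moved S M ↔ (j ∈ S ∧ j ∉ M) ∨ j - 1 ∈ M := by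
  simp only [moved, Finset.mem_union, Finset.mem_sdiff, Finset.mem_image]
  refine or_congr Iff.rfl ⟨?_, fun h => ⟨j - 1, h, by ring⟩⟩
  rintro ⟨a, ha, rfl⟩
  simpa using ha

/-- Heights after the movement, seen in the frame that moves with the free particles. -/
theorem height_moved (hM : IsMove S M) (h : ℝ) (z : ZMod n) (i : ℕ) :
    height h (moved S M) (z + 1) i
      = height h S z i + (if z + i + 1 ∈ S \ M then 1 else 0)
        - (if z + 1 ∈ S \ M then 1 else 0) := by
  induction i with
  | zero => simp [height]
  | succ i ih =>
    rw [height_succ, height_succ, ih]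
    push_cast
    have e1 : z + 1 + i + 1 = (z + i + 1) + 1 := by ring
    have e2 : z + (i + 1) + 1 = (z + i + 1) + 1 := by ring
    rw [e1, e2]
    generalize z + i + 1 = j
    have hm := hM.mem (j := j)
    simp only [mem_moved, Finset.mem_sdiff, add_sub_cancel_right]
    by_cases h1 : j ∈ S <;> by_cases h2 : j ∈ M <;> by_cases h3 : j + 1 ∈ S <;>
      by_cases h4 : j + 1 ∈ M <;> simp [h1, h2, h3, h4] at hm ⊢ <;> ring

theorem mem_holdbackParticles {j : ZMod n} :
    j ∈ holdbackParticles S ↔ j ∈ S ∧ j - 1 ∈ S ∧ j + 1 ∉ S := by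
  simp [holdbackParticles]

/-- The head of a cluster after the movement is the old head, or the particle behind it. -/
theorem holdback_moved (hM : IsMove S M) {j : ZMod n}
    (hj : j ∈ holdbackParticles (moved S M)) :
    (j ∈ holdbackParticles S ∧ j ∉ M) ∨ (j + 1 ∈ holdbackParticles S ∧ j + 1 ∈ M) := by
  simp only [mem_holdbackParticles, mem_moved, add_sub_cancel_right] at hj
  obtain ⟨h1, h2, h3⟩ := hj
  have hm1 := hM.mem (j := j - 1)
  have hm2 := hM.mem (j := j - 1 - 1)
  -- A particle that stays is not free, as all free particles move.
  have hf : j ∈ S → j ∉ M → ¬(j - 1 ∉ S ∧ j + 1 ∉ S) := fun h h' h'' =>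
    h' (hM.free_subset (by simpa [freeParticles] using ⟨h, h''⟩))
  simp only [mem_holdbackParticles, add_sub_cancel_right, sub_add_cancel] at hm1 hm2 ⊢
  have hm3 := hM.mem (j := j + 1)
  tauto

/-- A positive proportion of the clustered particles is held back in each time slot. -/
theorem card_clusterSites_le (hM : IsMove S M) :
    (clusterSites S).card ≤ 2 * (S \ M).card := by
  -- A clustered particle that moves is a head, and the particle behind it is blocked; so it is
  -- charged to that one.
  have h1 : clusterSites S ⊆ (S \ M) ∪ (S \ M).image (· + 1) := by
    intro j hj
    simp only [clusterSites, Finset.mem_filter] at hj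
    simp only [Finset.mem_union, Finset.mem_sdiff, Finset.mem_image]
    by_cases hjM : j ∈ M
    · refine Or.inr ⟨j - 1, ⟨?_, fun h => ?_⟩, by ring⟩
      · have := (hM.mem hjM).2
        tauto
      · exact (hM.mem h).2 (by simpa using hj.1)
    · exact Or.inl ⟨hj.1, hjM⟩
  have h2 := Finset.card_le_card h1
  have h3 := Finset.card_union_le (S \ M) ((S \ M).image (· + 1))
  have h4 : ((S \ M).image (· + 1)).card ≤ (S \ M).card := Finset.card_image_le
  omega

theorem card_sdiff_le_card_clusterSites (hM : IsMove S M) :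
    (S \ M).card ≤ (clusterSites S).card := by
  refine Finset.card_le_card fun j hj => ?_
  simp only [Finset.mem_sdiff, clusterSites, Finset.mem_filter] at hj ⊢
  refine ⟨hj.1, ?_⟩
  by_contra hc
  push Not at hc
  exact hj.2 (hM.free_subset (by simpa [freeParticles] using ⟨hj.1, hc⟩))

end Heights

/-! ### Means under laws on finite types -/

section Mean

/-- The mean of a function under a law on a finite type. -/
def mean {A : Type*} [Fintype A] (q : PMF A) (f : A → ℝ) : ℝ :=
  ∑ a, (q a).toReal * f a

variable {A B : Type*} [Fintype A] [Fintype B] (q : PMF A)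

theorem sum_toReal_eq_one : ∑ a, (q a).toReal = 1 := by
  rw [← ENNReal.toReal_sum fun a _ => q.apply_ne_top a, ← tsum_fintype (L := .unconditional A), q.tsum_coe,
    ENNReal.toReal_one]

theorem mean_const (c : ℝ) : mean q (fun _ => c) = c := by
  rw [mean, ← Finset.sum_mul, sum_toReal_eq_one, one_mul]

theorem mean_add (f g : A → ℝ) : mean q (fun a => f a + g a) = mean q f + mean q g := by
  simp [mean, mul_add, Finset.sum_add_distrib]

theorem mean_sub (f g : A → ℝ) : mean q (fun a => f a - g a) = mean q f - mean q g := by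
  simp [mean, mul_sub, Finset.sum_sub_distrib]

theorem mean_const_mul (c : ℝ) (f : A → ℝ) : mean q (fun a => c * f a) = c * mean q f := by
  simp only [mean, Finset.mul_sum]
  exact Finset.sum_congr rfl fun a _ => by ring

theorem mean_sum {J : Type*} (s : Finset J) (f : J → A → ℝ) :
    mean q (fun a => ∑ j ∈ s, f j a) = ∑ j ∈ s, mean q (f j) := by
  simp only [mean, Finset.mul_sum]
  exact Finset.sum_comm

theorem mean_mono {f g : A → ℝ} (hfg : ∀ a ∈ q.support, f a ≤ g a) : mean q f ≤ mean q g := by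
  refine Finset.sum_le_sum fun a _ => ?_
  by_cases ha : q a = 0
  · simp [ha]
  · exact mul_le_mul_of_nonneg_left (hfg a ((q.mem_support_iff a).mpr ha)) ENNReal.toReal_nonneg

theorem mean_pure (a : A) (f : A → ℝ) : mean (PMF.pure a) f = f a := by
  rw [mean, Finset.sum_eq_single a]
  · simp
  · intro b _ hb
    simp [hb]
  · simp

theorem mean_bind (g : A → PMF B) (f : B → ℝ) :
    mean (q.bind g) f = mean q fun a => mean (g a) f := by
  have h : ∀ b, ((q.bind g) b).toReal = ∑ a, (q a).toReal * (g a b).toReal := fun b => by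
    rw [PMF.bind_apply, tsum_fintype, ENNReal.toReal_sum fun a _ =>
      ENNReal.mul_ne_top (q.apply_ne_top a) ((g a).apply_ne_top b)]
    simp
  simp only [mean, h, Finset.sum_mul, Finset.mul_sum]
  rw [Finset.sum_comm]
  exact Finset.sum_congr rfl fun a _ => Finset.sum_congr rfl fun b _ => by ring

theorem mean_map (g : A → B) (f : B → ℝ) : mean (q.map g) f = mean q (f ∘ g) := by
  rw [← PMF.bind_pure_comp, mean_bind]
  simp [mean_pure, Function.comp_def]

end Mean

/-! ### The law of the moving particles -/

section Movement

variable {n : ℕ} [NeZero n] {S : Config n}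

theorem isMove_of_mem_support {p : I} {M : Finset (ZMod n)} (hM : M ∈ (movers p S).support) :
    IsMove S M := by
  rw [movers, PMF.support_map] at hM
  obtain ⟨K, hK, rfl⟩ := hM
  have hK' : K ⊆ holdbackParticles S := by
    by_contra hc
    exact hK (by simp [bernoulliSubset, hc])
  exact ⟨Finset.subset_union_left, Finset.union_subset_union_right hK'⟩

theorem mean_bernoulliSubset_mem (p : I) (H : Finset (ZMod n)) {a : ZMod n} (ha : a ∈ H) :
    mean (bernoulliSubset p H) (fun M => if a ∈ M then 1 else 0) = p := by
  have hp0 : (0 : ℝ) ≤ p := p.2.1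
  have hp1 : (0 : ℝ) ≤ 1 - p := sub_nonneg.mpr p.2.2
  have h1 : mean (bernoulliSubset p H) (fun M => if a ∈ M then 1 else 0)
      = ∑ M ∈ H.powerset, ((p : ℝ) ^ M.card * (1 - (p : ℝ)) ^ (H.card - M.card))
        * (if a ∈ M then 1 else 0) := by
    rw [mean]
    symm
    rw [← Finset.sum_subset (Finset.subset_univ H.powerset)]
    · refine Finset.sum_congr rfl fun M hM => ?_
      rw [bernoulliSubset, PMF.ofFinset_apply, if_pos (Finset.mem_powerset.mp hM),
        ENNReal.toReal_ofReal (by positivity)]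
    · intro M _ hM
      rw [bernoulliSubset, PMF.ofFinset_apply, if_neg (fun h => hM (Finset.mem_powerset.mpr h))]
      simp
  -- Only subsets containing `a` count; factoring out `p` leaves the binomial sum over `H.erase a`,
  -- which is 1.
  rw [h1, ← Finset.insert_erase ha, Finset.sum_powerset_insert (Finset.notMem_erase a H),
    Finset.insert_erase ha]
  have h2 : ∀ M ∈ (H.erase a).powerset, a ∉ M := fun M hM h =>
    Finset.notMem_erase a H (Finset.mem_powerset.mp hM h)
  have hc : H.card = (H.erase a).card + 1 := (Finset.card_erase_add_one ha).symm
  rw [Finset.sum_eq_zero fun M hM => by simp [h2 M hM], zero_add]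
  have h3 : ∀ M ∈ (H.erase a).powerset,
      (p : ℝ) ^ (insert a M).card * (1 - (p : ℝ)) ^ (H.card - (insert a M).card)
        * (if a ∈ insert a M then 1 else 0)
      = p * ((p : ℝ) ^ M.card * (1 - (p : ℝ)) ^ ((H.erase a).card - M.card)) := fun M hM => by
    rw [Finset.card_insert_of_notMem (h2 M hM), hc, Nat.add_sub_add_right]
    simp
    ring
  rw [Finset.sum_congr rfl h3, ← Finset.mul_sum, Finset.sum_pow_mul_eq_add_pow]
  simp

/-- Each particle at the head of a cluster moves with probability `p`. -/
theorem mean_movers_mem (p : I) {a : ZMod n} (ha : a ∈ holdbackParticles S) :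
    mean (movers p S) (fun M => if a ∈ M then 1 else 0) = p := by
  rw [movers, mean_map, ← mean_bernoulliSubset_mem p _ ha]
  congr 1
  funext M
  have : a ∉ freeParticles S := by
    simp only [mem_holdbackParticles] at ha
    simp only [freeParticles, Finset.mem_filter]
    tauto
  simp [this]

end Movement

/-! ### Exponential sums of heights -/

section Partition

variable {n : ℕ} [NeZero n]

/-- The exponential of the height, with inverse temperature `α`. -/
def expHeight (α h : ℝ) (S : Config n) (z : ZMod n) (i : ℕ) : ℝ :=
  Real.exp (α * height h S z i)

/-- The heads of clusters have weight `1 + ε`, and the other sites have weight `ε`. -/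
def weight (ε : ℝ) (S : Config n) (j : ZMod n) : ℝ :=
  ε + if j ∈ holdbackParticles S then 1 else 0

/-- The weighted sum of the exponentials of the heights to the right of `z`: a soft version of
the supremum of the heights. -/
def partition (α h ε : ℝ) (S : Config n) (z : ZMod n) : ℝ :=
  ∑' i : ℕ, weight ε S (z + i) * expHeight α h S z i

/-- The part of the sum that comes from the heads of clusters. -/
def headSum (α h : ℝ) (S : Config n) (z : ZMod n) : ℝ :=
  ∑' i : ℕ, (if z + i ∈ holdbackParticles S then 1 else 0) * expHeight α h S z i

variable {α h ε : ℝ} {S M : Finset (ZMod n)} {z : ZMod n}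

theorem expHeight_pos (i : ℕ) : 0 < expHeight α h S z i := Real.exp_pos _

theorem expHeight_succ {i : ℕ} (hi : z + i + 1 ∈ S) :
    expHeight α h S z (i + 1) = expHeight α h S z i * Real.exp (α * (1 - h)) := by
  rw [expHeight, expHeight, height_succ, if_pos hi, ← Real.exp_add]
  ring_nf

theorem summable_mul_of_le {E : ℕ → ℝ} (hE : Summable E) (hE0 : ∀ i, 0 ≤ E i) {u : ℕ → ℝ}
    {C : ℝ} (hu0 : ∀ i, 0 ≤ u i) (hu : ∀ i, u i ≤ C) : Summable fun i => u i * E i :=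
  Summable.of_nonneg_of_le (fun i => mul_nonneg (hu0 i) (hE0 i))
    (fun i => mul_le_mul_of_nonneg_right (hu i) (hE0 i)) (hE.mul_left C)

theorem weight_nonneg (hε : 0 ≤ ε) (j : ZMod n) : 0 ≤ weight ε S j := by
  unfold weight; split_ifs <;> linarith

theorem weight_le (j : ZMod n) : weight ε S j ≤ ε + 1 := by
  unfold weight; split_ifs <;> linarith

theorem indicator_nonneg {P : Prop} [Decidable P] : (0 : ℝ) ≤ if P then 1 else 0 := by
  split_ifs <;> norm_num

theorem indicator_le_one {P : Prop} [Decidable P] : (if P then (1 : ℝ) else 0) ≤ 1 := by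
  split_ifs <;> norm_num

/-- Used where a cluster head is matched with a term one or two indices further on: the initial
terms left unmatched are nonnegative. -/
theorem tsum_add_nat_le {f : ℕ → ℝ} (hf : Summable f) (hf0 : ∀ i, 0 ≤ f i) (k : ℕ) :
    ∑' i, f (i + k) ≤ ∑' i, f i := by
  rw [← hf.sum_add_tsum_nat_add k]
  exact le_add_of_nonneg_left (Finset.sum_nonneg fun i _ => hf0 i)

theorem summable_partition (hε : 0 ≤ ε) (hE : Summable (expHeight α h S z)) :
    Summable fun i : ℕ => weight ε S (z + i) * expHeight α h S z i :=
  summable_mul_of_le hE (fun i => (expHeight_pos i).le) (fun _ => weight_nonneg hε _)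
    fun _ => weight_le _

theorem summable_headSum (hE : Summable (expHeight α h S z)) :
    Summable fun i : ℕ =>
      (if z + i ∈ holdbackParticles S then (1 : ℝ) else 0) * expHeight α h S z i :=
  summable_mul_of_le hE (fun i => (expHeight_pos i).le) (fun _ => indicator_nonneg)
    fun _ => indicator_le_one

theorem headSum_nonneg : 0 ≤ headSum α h S z :=
  tsum_nonneg fun i => mul_nonneg indicator_nonneg (expHeight_pos i).le

theorem partition_eq (hE : Summable (expHeight α h S z)) :
    partition α h ε S z = ε * ∑' i, expHeight α h S z i + headSum α h S z := by
  rw [partition, headSum, ← tsum_mul_left, ← (hE.mul_left ε).tsum_add (summable_headSum hE)]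
  exact tsum_congr fun i => by rw [weight]; ring

/-- The term `i = 0` has height 0 and weight at least `ε`. This keeps the logarithms under control.
-/
theorem le_partition (hε : 0 ≤ ε) (hE : Summable (expHeight α h S z)) :
    ε ≤ partition α h ε S z := by
  have h1 := (summable_partition hε hE).le_tsum 0
    fun i _ => mul_nonneg (weight_nonneg hε _) (expHeight_pos i).le
  refine le_trans ?_ h1
  simp only [expHeight, height, Finset.range_zero, Finset.sum_empty, mul_zero, Real.exp_zero,
    mul_one, weight]
  exact le_add_of_nonneg_right indicator_nonneg

/-- The effect of a relocation on the weighted sum. -/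
theorem partition_relocate_le (hα : 0 ≤ α) (hε : 0 < ε) (hE : Summable (expHeight α h S z))
    {x : ZMod n} (hx : x ∈ S) (y : ZMod n) :
    partition α h ε (insert y (S.erase x)) z
      ≤ ((1 + 1 / ε) * Real.exp α) * partition α h ε S z := by
  have hle : ∀ i, expHeight α h (insert y (S.erase x)) z i
      ≤ Real.exp α * expHeight α h S z i := fun i => by
    rw [expHeight, expHeight, ← Real.exp_add, Real.exp_le_exp]
    nlinarith [height_relocate_le h hx y z i]
  have hE' : Summable (expHeight α h (insert y (S.erase x)) z) :=
    Summable.of_nonneg_of_le (fun i => (expHeight_pos i).le) hle (hE.mul_left _)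
  unfold partition
  rw [← tsum_mul_left]
  refine (summable_partition hε.le hE').tsum_le_tsum (fun i => ?_)
    ((summable_partition hε.le hE).mul_left _)
  have h1 : ε ≤ weight ε S (z + i) := le_add_of_nonneg_right indicator_nonneg
  -- The worst case is a site of weight `ε` that becomes a head.
  have h2 : ε + 1 ≤ (1 + 1 / ε) * weight ε S (z + i) := by
    calc ε + 1 = (1 + 1 / ε) * ε := by field_simp
      _ ≤ _ := mul_le_mul_of_nonneg_left h1 (by positivity)
  calc _ ≤ ((1 + 1 / ε) * weight ε S (z + i)) * (Real.exp α * expHeight α h S z i) :=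
        mul_le_mul ((weight_le _).trans h2) (hle i) (expHeight_pos i).le
          (by linarith)
    _ = _ := by ring

theorem summable_relocate (hα : 0 ≤ α) (hE : Summable (expHeight α h S z))
    {x : ZMod n} (hx : x ∈ S) (y : ZMod n) :
    Summable (expHeight α h (insert y (S.erase x)) z) := by
  refine Summable.of_nonneg_of_le (fun i => (expHeight_pos i).le) (fun i => ?_)
    (hE.mul_left (Real.exp α))
  rw [expHeight, expHeight, ← Real.exp_add, Real.exp_le_exp]
  nlinarith [height_relocate_le h hx y z i]

/-- The factor on the left does not depend on `i`, so it comes out of every sum; its logarithm is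
the gain of the Lyapunov function. -/
theorem expHeight_moved (hM : IsMove S M) (i : ℕ) :
    Real.exp (α * if z + 1 ∈ S \ M then 1 else 0) * expHeight α h (moved S M) (z + 1) i
      = expHeight α h S z i * Real.exp (α * if z + i + 1 ∈ S \ M then 1 else 0) := by
  rw [expHeight, expHeight, height_moved hM, ← Real.exp_add, ← Real.exp_add]
  ring_nf

theorem summable_moved (hα : 0 ≤ α) (hM : IsMove S M) (hE : Summable (expHeight α h S z)) :
    Summable (expHeight α h (moved S M) (z + 1)) := by
  refine Summable.of_nonneg_of_le (fun i => (expHeight_pos i).le) (fun i => ?_)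
    (hE.mul_right (Real.exp (α * 1)))
  have h1 : (1 : ℝ) ≤ Real.exp (α * if z + 1 ∈ S \ M then 1 else 0) :=
    Real.one_le_exp (mul_nonneg hα indicator_nonneg)
  calc _ ≤ _ := le_mul_of_one_le_left (expHeight_pos i).le h1
    _ = _ := expHeight_moved hM i
    _ ≤ _ := by
      gcongr
      · exact (expHeight_pos i).le
      · exact indicator_le_one

/-- The particles that are held back are dominated by the heads of their clusters. -/
theorem tsum_held_le (hα : 0 < α) (hα1 : α ≤ 1) (hh : h ≤ 1 / 2) (hM : IsMove S M)
    (hE : Summable (expHeight α h S z)) :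
    (Real.exp α - 1) * ∑' i : ℕ, (if z + i + 1 ∈ S \ M then 1 else 0) * expHeight α h S z i
      ≤ 4 * headSum α h S z := by
  classical
  -- `B` consists of the clustered particles, described so that each one is a head or has its right
  -- neighbour in `B`.
  set B : Finset (ZMod n) := S.filter fun j => j ∈ holdbackParticles S ∨ j + 1 ∈ S with hB
  set e := Real.exp (α * (1 - h)) with he
  have hpos := fun i => (expHeight_pos (α := α) (h := h) (S := S) (z := z) i)
  have sB1 : Summable fun i : ℕ =>
      (if z + i + 1 ∈ B then (1 : ℝ) else 0) * expHeight α h S z i :=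
    summable_mul_of_le hE (fun i => (hpos i).le) (fun _ => indicator_nonneg)
      fun _ => indicator_le_one
  have sM : Summable fun i : ℕ =>
      (if z + i + 1 ∈ S \ M then (1 : ℝ) else 0) * expHeight α h S z i :=
    summable_mul_of_le hE (fun i => (hpos i).le) (fun _ => indicator_nonneg)
      fun _ => indicator_le_one
  have sH := summable_headSum hE
  set AB := ∑' i : ℕ, (if z + i + 1 ∈ B then 1 else 0) * expHeight α h S z i with hAB
  have hAB0 : 0 ≤ AB := tsum_nonneg fun i => mul_nonneg indicator_nonneg (hpos i).le
  have h1 : ∑' i : ℕ, (if z + i + 1 ∈ S \ M then 1 else 0) * expHeight α h S z i ≤ AB := by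
    refine sM.tsum_le_tsum (fun i => mul_le_mul_of_nonneg_right ?_ (hpos i).le) sB1
    have : z + i + 1 ∈ S \ M → z + i + 1 ∈ B := fun hj => by
      rw [Finset.mem_sdiff] at hj
      rw [hB, Finset.mem_filter, mem_holdbackParticles]
      refine ⟨hj.1, ?_⟩
      by_contra hc
      refine hj.2 (hM.free_subset ?_)
      simp only [freeParticles, Finset.mem_filter]
      tauto
    by_cases hj : z + i + 1 ∈ S \ M
    · rw [if_pos hj, if_pos (this hj)]
    · rw [if_neg hj]
      exact indicator_nonneg
  -- Reading one more particle multiplies the exponential by `e`. The enlarged term is then charged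
  -- to the head sum, or to the next term of `AB`. This is a geometric series along the cluster,
  -- dominated by its head.
  have h2 : e * AB ≤ headSum α h S z + AB := by
    have hf : ∀ i : ℕ, 0 ≤ ((if z + i ∈ holdbackParticles S then (1 : ℝ) else 0)
        + (if z + i + 1 ∈ B then 1 else 0)) * expHeight α h S z i := fun i =>
      mul_nonneg (add_nonneg indicator_nonneg indicator_nonneg) (hpos i).le
    have sf : Summable fun i : ℕ => ((if z + i ∈ holdbackParticles S then (1 : ℝ) else 0)
        + (if z + i + 1 ∈ B then 1 else 0)) * expHeight α h S z i := by
      simpa only [add_mul] using sH.add sB1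
    have hsum : headSum α h S z + AB
        = ∑' i : ℕ, ((if z + i ∈ holdbackParticles S then (1 : ℝ) else 0)
        + (if z + i + 1 ∈ B then 1 else 0)) * expHeight α h S z i := by
      simp only [add_mul]
      exact (sH.tsum_add sB1).symm
    rw [hsum]
    refine le_trans ?_ (tsum_add_nat_le sf hf 1)
    rw [hAB, ← tsum_mul_left]
    refine (sB1.mul_left e).tsum_le_tsum (fun i => ?_) ((summable_nat_add_iff 1).mpr sf)
    push_cast
    rw [← add_assoc]
    by_cases hj : z + i + 1 ∈ B
    · have hjS : z + i + 1 ∈ S := (Finset.mem_filter.mp hj).1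
      have hj2 : z + i + 1 ∈ holdbackParticles S ∨ z + i + 1 + 1 ∈ B := by
        rcases (Finset.mem_filter.mp hj).2 with h | h
        · exact Or.inl h
        · refine Or.inr ?_
          rw [hB, Finset.mem_filter, mem_holdbackParticles, add_sub_cancel_right]
          tauto
      rw [if_pos hj, expHeight_succ hjS, one_mul, ← he, mul_comm (expHeight α h S z i)]
      have : (1 : ℝ) ≤ (if z + i + 1 ∈ holdbackParticles S then (1 : ℝ) else 0)
          + (if z + i + 1 + 1 ∈ B then 1 else 0) := by
        rcases hj2 with h | h <;> simp only [h, if_true]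
        · exact le_add_of_nonneg_right indicator_nonneg
        · exact le_add_of_nonneg_left indicator_nonneg
      exact le_mul_of_one_le_left (mul_nonneg (Real.exp_pos _).le (hpos i).le) this
    · rw [if_neg hj, zero_mul, mul_zero]
      exact mul_nonneg (add_nonneg indicator_nonneg indicator_nonneg) (hpos _).le
  -- This uses `1 - h ≥ 1 / 2`. Together with `exp α - 1 ≤ 2 α` it gives the constant 4.
  have h3 : α / 2 ≤ e - 1 := by
    have := Real.add_one_le_exp (α * (1 - h))
    nlinarith
  have h4 : Real.exp α - 1 ≤ 2 * α := by
    have := Real.abs_exp_sub_one_sub_id_le (x := α) (by rw [abs_of_pos hα]; exact hα1)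
    have := (abs_le.mp this).2
    nlinarith
  have h5 : α / 2 * AB ≤ headSum α h S z :=
    (mul_le_mul_of_nonneg_right h3 hAB0).trans (by linarith)
  calc _ ≤ (2 * α) * AB := mul_le_mul h4 h1
        (tsum_nonneg fun i => mul_nonneg indicator_nonneg (hpos i).le) (by linarith)
    _ ≤ _ := by linarith

end Partition

/-! ### Drift of the Lyapunov function -/

section Drift

variable {n : ℕ} [NeZero n] {α h ε : ℝ} {S M : Finset (ZMod n)} {z : ZMod n}

/-- The contribution of the heads of clusters to the weighted sum after the movement. -/
def movedHeadSum (α h : ℝ) (S M : Finset (ZMod n)) (z : ZMod n) : ℝ :=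
  ∑' i : ℕ, (if z + i ∈ holdbackParticles S then 1 else 0) * expHeight α h S z i
    * (Real.exp (α * h) - (Real.exp (α * h) - Real.exp (α * (2 * h - 1)))
      * (if z + i ∈ M then 1 else 0))

theorem summable_movedHeadSum (hE : Summable (expHeight α h S z)) (M : Finset (ZMod n)) :
    Summable fun i : ℕ => (if z + i ∈ holdbackParticles S then (1 : ℝ) else 0)
      * expHeight α h S z i
      * (Real.exp (α * h) - (Real.exp (α * h) - Real.exp (α * (2 * h - 1)))
        * (if z + i ∈ M then 1 else 0)) := by
  have h1 := Real.exp_pos (α * h)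
  have h2 := Real.exp_pos (α * (2 * h - 1))
  have := summable_mul_of_le (summable_headSum hE)
    (fun i => mul_nonneg indicator_nonneg (expHeight_pos i).le)
    (u := fun i : ℕ => Real.exp (α * h) - (Real.exp (α * h) - Real.exp (α * (2 * h - 1)))
        * (if z + i ∈ M then 1 else 0)) (C := Real.exp (α * h) + Real.exp (α * (2 * h - 1)))
    (fun i => by split_ifs <;> linarith) (fun i => by split_ifs <;> linarith)
  refine this.congr fun i => mul_comm _ _

/-- Movement creates no head without an old one to charge it to (`holdback_moved`). In the moving
frame the charged head is one index further on if it stayed and two if it moved. Undoing one or two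
factors `exp (α (1 - h))` against the gain `exp α` leaves `exp (α h)` or `exp (α (2h - 1))`. -/
theorem tsum_head_moved_le (hα : 0 ≤ α) (hM : IsMove S M) (hE : Summable (expHeight α h S z)) :
    ∑' i : ℕ, (if z + 1 + i ∈ holdbackParticles (moved S M) then 1 else 0)
        * (expHeight α h S z i * Real.exp (α * if z + i + 1 ∈ S \ M then 1 else 0))
      ≤ movedHeadSum α h S M z := by
  set g₁ : ℕ → ℝ := fun i => (if z + i ∈ holdbackParticles S ∧ z + i ∉ M then Real.exp (α * h)
    else 0) * expHeight α h S z i with hg₁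
  set g₂ : ℕ → ℝ := fun i => (if z + i ∈ holdbackParticles S ∧ z + i ∈ M then
    Real.exp (α * (2 * h - 1)) else 0) * expHeight α h S z i with hg₂
  have hpos := fun i => (expHeight_pos (α := α) (h := h) (S := S) (z := z) i)
  have p₁ : ∀ i, 0 ≤ g₁ i := fun i => mul_nonneg (by split_ifs <;> positivity) (hpos i).le
  have p₂ : ∀ i, 0 ≤ g₂ i := fun i => mul_nonneg (by split_ifs <;> positivity) (hpos i).le
  have s₁ : Summable g₁ := summable_mul_of_le hE (fun i => (hpos i).le)
    (C := Real.exp (α * h)) (fun i => by split_ifs <;> positivity)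
    (fun i => by split_ifs <;> simp [Real.exp_nonneg])
  have s₂ : Summable g₂ := summable_mul_of_le hE (fun i => (hpos i).le)
    (C := Real.exp (α * (2 * h - 1))) (fun i => by split_ifs <;> positivity)
    (fun i => by split_ifs <;> simp [Real.exp_nonneg])
  have s₁' : Summable fun i => g₁ (i + 1) := (summable_nat_add_iff 1).mpr s₁
  have s₂' : Summable fun i => g₂ (i + 2) := (summable_nat_add_iff 2).mpr s₂
  have hpt : ∀ i : ℕ, (if z + 1 + i ∈ holdbackParticles (moved S M) then 1 else 0)
      * (expHeight α h S z i * Real.exp (α * if z + i + 1 ∈ S \ M then 1 else 0))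
      ≤ g₁ (i + 1) + g₂ (i + 2) := fun i => by
    by_cases hj : z + 1 + i ∈ holdbackParticles (moved S M)
    · rw [if_pos hj, one_mul]
      have hle : expHeight α h S z i * Real.exp (α * if z + i + 1 ∈ S \ M then 1 else 0)
          ≤ expHeight α h S z i * Real.exp α := by
        refine mul_le_mul_of_nonneg_left (Real.exp_le_exp.mpr ?_) (hpos i).le
        exact mul_le_of_le_one_right hα indicator_le_one
      have e0 : z + 1 + (i : ZMod n) = z + i + 1 := by ring
      have e1 : z + ((i + 1 : ℕ) : ZMod n) = z + i + 1 := by push_cast; ring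
      have e2 : z + ((i + 2 : ℕ) : ZMod n) = z + i + 1 + 1 := by push_cast; ring
      rw [e0] at hj
      refine hle.trans ?_
      rcases holdback_moved hM hj with hc | hc
      · refine le_trans (le_of_eq ?_) (le_add_of_nonneg_right (p₂ _))
        have hS := (mem_holdbackParticles.mp hc.1).1
        simp only [hg₁, e1]
        rw [if_pos hc, expHeight_succ hS, mul_left_comm, ← Real.exp_add]
        ring_nf
      · refine le_trans (le_of_eq ?_) (le_add_of_nonneg_left (p₁ _))
        have hS := mem_holdbackParticles.mp hc.1
        rw [add_sub_cancel_right] at hS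
        simp only [hg₂, e2]
        rw [if_pos hc, show i + 2 = (i + 1) + 1 from rfl,
          expHeight_succ (by rw [e1]; exact hS.1), expHeight_succ hS.2.1, mul_assoc,
          mul_left_comm, ← Real.exp_add, ← Real.exp_add]
        ring_nf
    · rw [if_neg hj, zero_mul]
      exact add_nonneg (p₁ _) (p₂ _)
  have sL : Summable fun i : ℕ => (if z + 1 + i ∈ holdbackParticles (moved S M) then (1 : ℝ)
      else 0) * (expHeight α h S z i * Real.exp (α * if z + i + 1 ∈ S \ M then 1 else 0)) :=
    Summable.of_nonneg_of_le
      (fun i => mul_nonneg indicator_nonneg (mul_nonneg (hpos i).le (Real.exp_pos _).le))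
      hpt (s₁'.add s₂')
  calc _ ≤ ∑' i, (g₁ (i + 1) + g₂ (i + 2)) := sL.tsum_le_tsum hpt (s₁'.add s₂')
    _ = ∑' i, g₁ (i + 1) + ∑' i, g₂ (i + 2) := s₁'.tsum_add s₂'
    _ ≤ ∑' i, g₁ i + ∑' i, g₂ i := add_le_add (tsum_add_nat_le s₁ p₁ 1) (tsum_add_nat_le s₂ p₂ 2)
    _ = ∑' i, (g₁ i + g₂ i) := (s₁.tsum_add s₂).symm
    _ = _ := tsum_congr fun i => by
      simp only [hg₁, hg₂]
      by_cases h1 : z + i ∈ holdbackParticles S <;> by_cases h2 : z + i ∈ M <;>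
        simp [h1, h2] <;> ring

/-- The background part grows only at held-back particles, which `tsum_held_le` charges to the
heads; the head part is handled by `tsum_head_moved_le`. -/
theorem partition_moved_le (hα : 0 < α) (hα1 : α ≤ 1) (hh : h ≤ 1 / 2) (hε : 0 ≤ ε)
    (hM : IsMove S M) (hE : Summable (expHeight α h S z)) :
    Real.exp (α * if z + 1 ∈ S \ M then 1 else 0) * partition α h ε (moved S M) (z + 1)
      ≤ ε * ∑' i, expHeight α h S z i + 4 * ε * headSum α h S z + movedHeadSum α h S M z := by
  have hpos := fun i => (expHeight_pos (α := α) (h := h) (S := S) (z := z) i)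
  have hE' := summable_moved hα.le hM hE
  have sM : Summable fun i : ℕ =>
      (if z + i + 1 ∈ S \ M then (1 : ℝ) else 0) * expHeight α h S z i :=
    summable_mul_of_le hE (fun i => (hpos i).le) (fun _ => indicator_nonneg)
      fun _ => indicator_le_one
  have hexp : ∀ i : ℕ, Real.exp (α * if z + i + 1 ∈ S \ M then 1 else 0)
      = 1 + (Real.exp α - 1) * if z + i + 1 ∈ S \ M then 1 else 0 := fun i => by
    split_ifs <;> simp
  rw [partition_eq hE', mul_add, headSum, mul_left_comm]
  have e1 : ∑' i : ℕ, Real.exp (α * if z + 1 ∈ S \ M then 1 else 0)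
      * expHeight α h (moved S M) (z + 1) i
      = ∑' i, expHeight α h S z i + (Real.exp α - 1)
        * ∑' i : ℕ, (if z + i + 1 ∈ S \ M then 1 else 0) * expHeight α h S z i := by
    rw [← tsum_mul_left, ← hE.tsum_add (sM.mul_left _)]
    refine tsum_congr fun i => ?_
    rw [expHeight_moved hM, hexp]
    ring
  have e2 := tsum_head_moved_le hα.le hM hE
  have e3 : ∑' i : ℕ, Real.exp (α * if z + 1 ∈ S \ M then 1 else 0)
      * ((if z + 1 + i ∈ holdbackParticles (moved S M) then 1 else 0)
        * expHeight α h (moved S M) (z + 1) i)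
      = ∑' i : ℕ, (if z + 1 + i ∈ holdbackParticles (moved S M) then 1 else 0)
        * (expHeight α h S z i * Real.exp (α * if z + i + 1 ∈ S \ M then 1 else 0)) :=
    tsum_congr fun i => by rw [mul_left_comm, expHeight_moved hM]
  rw [tsum_mul_left] at e1 e3
  rw [e1, e3, mul_add]
  have := mul_le_mul_of_nonneg_left (tsum_held_le hα hα1 hh hM hE) hε
  linarith

/-- The mean of the exponential of the displacement of the head of a cluster. -/
theorem mean_head_displacement_le {p : ℝ} (hp0 : 0 ≤ p) (hp1 : p ≤ 1) (hα : 0 < α)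
    (hα1 : α ≤ 1) (hh : h = p / (1 + p)) :
    Real.exp (α * h) - (Real.exp (α * h) - Real.exp (α * (2 * h - 1))) * p ≤ 1 + α ^ 2 := by
  have hmul : h * (1 + p) = p := by rw [hh]; field_simp
  have hh0 : 0 ≤ h := by rw [hh]; positivity
  have hh1 : h ≤ 1 := by nlinarith
  have bound : ∀ u : ℝ, |u| ≤ 1 → Real.exp (α * u) ≤ 1 + α * u + α ^ 2 := fun u hu => by
    have h1 : |α * u| ≤ α := by
      rw [abs_mul, abs_of_pos hα]
      exact mul_le_of_le_one_right hα.le hu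
    have h2 := (abs_le.mp (Real.abs_exp_sub_one_sub_id_le (h1.trans hα1))).2
    have h3 : (α * u) ^ 2 ≤ α ^ 2 := sq_le_sq.mpr (by rwa [abs_of_pos hα])
    linarith
  have b1 := mul_le_mul_of_nonneg_left (bound h (abs_le.mpr ⟨by linarith, hh1⟩))
    (sub_nonneg.mpr hp1)
  have b2 := mul_le_mul_of_nonneg_left
    (bound (2 * h - 1) (abs_le.mpr ⟨by linarith, by linarith⟩)) hp0
  -- The first-order term in `α` is the mean displacement, which vanishes exactly at the critical
  -- `h`.
  have b3 : (1 - p) * (1 + α * h + α ^ 2) + p * (1 + α * (2 * h - 1) + α ^ 2)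
      = 1 + α ^ 2 + α * (h * (1 + p) - p) := by ring
  rw [hmul, sub_self, mul_zero, add_zero] at b3
  linarith

theorem mean_movedHeadSum_le (p : I) (hα : 0 < α) (hα1 : α ≤ 1)
    (hh : h = (p : ℝ) / (1 + p)) (hE : Summable (expHeight α h S z)) :
    mean (movers p S) (fun M => movedHeadSum α h S M z) ≤ (1 + α ^ 2) * headSum α h S z := by
  have hsum : mean (movers p S) (fun M => movedHeadSum α h S M z)
      = ∑' i : ℕ, mean (movers p S) fun M =>
        (if z + i ∈ holdbackParticles S then (1 : ℝ) else 0) * expHeight α h S z i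
        * (Real.exp (α * h) - (Real.exp (α * h) - Real.exp (α * (2 * h - 1)))
          * (if z + i ∈ M then 1 else 0)) := by
    simp only [mean, movedHeadSum, ← tsum_mul_left]
    rw [Summable.tsum_finsetSum fun M _ => (summable_movedHeadSum hE M).mul_left _]
  have hs : Summable fun i : ℕ => mean (movers p S) fun M =>
        (if z + i ∈ holdbackParticles S then (1 : ℝ) else 0) * expHeight α h S z i
        * (Real.exp (α * h) - (Real.exp (α * h) - Real.exp (α * (2 * h - 1)))
          * (if z + i ∈ M then 1 else 0)) :=
    summable_sum fun M _ => (summable_movedHeadSum hE M).mul_left _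
  rw [hsum, headSum, ← tsum_mul_left]
  refine hs.tsum_le_tsum (fun i => ?_) ((summable_headSum hE).mul_left _)
  rw [mean_const_mul, mean_sub, mean_const, mean_const_mul, mul_comm]
  by_cases hj : z + i ∈ holdbackParticles S
  · rw [mean_movers_mem p hj]
    exact mul_le_mul_of_nonneg_right (mean_head_displacement_le p.2.1 p.2.2 hα hα1 hh)
      (mul_nonneg indicator_nonneg (expHeight_pos i).le)
  · simp [hj]

/-- The Lyapunov function: its mean decreases in proportion to the number of clustered particles,
up to an error of second order in `α`. -/
def lyapunov (α h ε : ℝ) (S : Config n) : ℝ :=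
  ∑ z, Real.log (partition α h ε S z)

/-- The inequality `log x ≤ x - 1` leaves an expression in which the moves of the heads enter
linearly, so its mean needs only their individual probabilities. The factor at the base point enters
exactly, as `-α` for each held-back particle. -/
theorem lyapunov_moved_le (hα : 0 < α) (hα1 : α ≤ 1) (hh : h ≤ 1 / 2) (hε : 0 < ε)
    (hM : IsMove S M) (hE : ∀ z, Summable (expHeight α h S z)) :
    lyapunov α h ε (moved S M) ≤ lyapunov α h ε S
      + ∑ z, ((ε * ∑' i, expHeight α h S z i + 4 * ε * headSum α h S z
        + movedHeadSum α h S M z) / partition α h ε S z - 1) - α * (S \ M).card := by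
  -- Reindexing by `z + 1` costs nothing after summing over the circle, and it passes to the moving
  -- frame.
  have h1 : lyapunov α h ε (moved S M)
      = ∑ z, Real.log (partition α h ε (moved S M) (z + 1)) :=
    (Equiv.sum_comp (Equiv.addRight (1 : ZMod n)) fun z =>
      Real.log (partition α h ε (moved S M) z)).symm
  have h2 : ((S \ M).card : ℝ) = ∑ z, if z + 1 ∈ S \ M then 1 else 0 := by
    refine Eq.trans ?_ (Equiv.sum_comp (Equiv.addRight (1 : ZMod n))
      fun z => if z ∈ S \ M then (1 : ℝ) else 0).symm
    rw [Finset.sum_boole, Finset.filter_univ_mem]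
  rw [h1, h2, Finset.mul_sum, lyapunov, ← Finset.sum_add_distrib, ← Finset.sum_sub_distrib]
  refine Finset.sum_le_sum fun z _ => ?_
  have hR : 0 < partition α h ε S z := hε.trans_le (le_partition hε.le (hE z))
  have hR' : 0 < partition α h ε (moved S M) (z + 1) :=
    hε.trans_le (le_partition hε.le (summable_moved hα.le hM (hE z)))
  have h3 := div_le_div_of_nonneg_right (partition_moved_le hα hα1 hh hε.le hM (hE z)) hR.le
  have h4 := Real.log_le_sub_one_of_pos (x := Real.exp (α * if z + 1 ∈ S \ M then 1 else 0)
    * partition α h ε (moved S M) (z + 1) / partition α h ε S z) (by positivity)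
  rw [Real.log_div (by positivity) hR.ne', Real.log_mul (Real.exp_pos _).ne' hR'.ne',
    Real.log_exp] at h4
  linarith

theorem mean_lyapunov_moved_le (p : I) (hα : 0 < α) (hα1 : α ≤ 1)
    (hh : h = (p : ℝ) / (1 + p)) (hε : 0 < ε) (hE : ∀ z, Summable (expHeight α h S z)) :
    mean (movers p S) (fun M => lyapunov α h ε (moved S M))
      ≤ lyapunov α h ε S + n * (α ^ 2 + 4 * ε) - α * ((clusterSites S).card / 2) := by
  have hp0 : (0 : ℝ) ≤ p := p.2.1
  have hh2 : h ≤ 1 / 2 := by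
    rw [hh, div_le_div_iff₀ (by linarith) two_pos]
    linarith [p.2.2]
  have h1 : mean (movers p S) (fun M => lyapunov α h ε (moved S M))
      ≤ mean (movers p S) fun M => lyapunov α h ε S
      + ∑ z, ((ε * ∑' i, expHeight α h S z i + 4 * ε * headSum α h S z
        + movedHeadSum α h S M z) * (partition α h ε S z)⁻¹ - 1)
      - α * ((clusterSites S).card / 2) := by
    refine mean_mono _ fun M hM => ?_
    have hM' := isMove_of_mem_support hM
    have h2 := lyapunov_moved_le hα hα1 hh2 hε hM' hE
    have h3 : ((clusterSites S).card : ℝ) ≤ 2 * (S \ M).card := by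
      exact_mod_cast card_clusterSites_le hM'
    have h4 := mul_le_mul_of_nonneg_left h3 hα.le
    simp only [div_eq_mul_inv (_ + _ : ℝ)] at h2
    linarith
  refine h1.trans ?_
  rw [mean_sub, mean_add, mean_const, mean_const, mean_sum]
  have h5 : ∀ z ∈ Finset.univ, mean (movers p S) (fun M =>
      (ε * ∑' i, expHeight α h S z i + 4 * ε * headSum α h S z
        + movedHeadSum α h S M z) * (partition α h ε S z)⁻¹ - 1) ≤ α ^ 2 + 4 * ε := by
    intro z _
    have hR : 0 < partition α h ε S z := hε.trans_le (le_partition hε.le (hE z))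
    simp only [mul_comm _ (partition α h ε S z)⁻¹]
    rw [mean_sub, mean_const_mul, mean_add, mean_const, mean_const, mul_comm,
      ← div_eq_mul_inv, sub_le_iff_le_add, div_le_iff₀ hR]
    have h6 := mean_movedHeadSum_le p hα hα1 hh (hE z)
    have h7 : 0 ≤ (α ^ 2 + 4 * ε) * (ε * ∑' i, expHeight α h S z i) :=
      mul_nonneg (by positivity) (mul_nonneg hε.le (tsum_nonneg fun i => (expHeight_pos i).le))
    have h8 : (0 : ℝ) ≤ headSum α h S z := headSum_nonneg
    rw [partition_eq (hE z)]
    linarith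
  have h6 := Finset.sum_le_sum h5
  simp only [Finset.sum_const, Finset.card_univ, ZMod.card, nsmul_eq_mul] at h6
  linarith

theorem lyapunov_relocate_le (hα : 0 ≤ α) (hε : 0 < ε)
    (hE : ∀ z, Summable (expHeight α h S z)) {x : ZMod n} (hx : x ∈ S) (y : ZMod n) :
    lyapunov α h ε (insert y (S.erase x))
      ≤ lyapunov α h ε S + n * (α + Real.log (1 + 1 / ε)) := by
  have h1 : ∀ z ∈ Finset.univ, Real.log (partition α h ε (insert y (S.erase x)) z)
      ≤ Real.log (partition α h ε S z) + (α + Real.log (1 + 1 / ε)) := fun z _ => by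
    have hR : 0 < partition α h ε S z := hε.trans_le (le_partition hε.le (hE z))
    have hR' : 0 < partition α h ε (insert y (S.erase x)) z :=
      hε.trans_le (le_partition hε.le (summable_relocate hα (hE z) hx y))
    have h2 := Real.log_le_log hR' (partition_relocate_le hα hε (hE z) hx y)
    rw [Real.log_mul (by positivity) hR.ne', Real.log_mul (by positivity) (Real.exp_pos _).ne',
      Real.log_exp] at h2
    linarith
  have h2 := Finset.sum_le_sum h1
  rw [Finset.sum_add_distrib] at h2
  rwa [Finset.sum_const, Finset.card_univ, ZMod.card, nsmul_eq_mul] at h2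

theorem perturbProb_le {lam : ℝ} (hlam : 0 ≤ lam) : (perturbProb lam n : ℝ) ≤ lam / n := by
  rw [perturbProb, Set.coe_projIcc]
  exact max_le (by positivity) (min_le_right _ _)

theorem mean_coin (q : I) (f : Bool → ℝ) :
    mean (coin q) f = q * f true + (1 - q) * f false := by
  have h0 : (0 : ℝ) ≤ q := q.2.1
  have h1 : (0 : ℝ) ≤ 1 - q := sub_nonneg.mpr q.2.2
  simp [mean, coin, ENNReal.toReal_ofReal, h0, h1]

/-- A perturbation is rare. -/
theorem mean_perturbation_le {lam : ℝ} (hlam : 0 ≤ lam) (S : Config n)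
    {f : Option (ZMod n × ZMod n) → ℝ} {c K : ℝ} (hK : 0 ≤ K) (hnone : f none ≤ c)
    (hsome : ∀ x ∈ S, ∀ y, f (some (x, y)) ≤ c + K) :
    mean (perturbation lam S) f ≤ c + lam / n * K := by
  have hl : 0 ≤ lam / n * K := by positivity
  unfold perturbation
  split_ifs with hS
  · rw [mean_bind, mean_coin]
    simp only [if_true, Bool.false_eq_true, if_false, mean_pure, mean_map]
    have h1 : mean (relocation S hS.2) (f ∘ some) ≤ mean (relocation S hS.2) fun _ => c + K := by
      refine mean_mono _ fun o ho => ?_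
      simp only [relocation, PMF.mem_support_bind_iff, PMF.mem_support_map_iff] at ho
      obtain ⟨x, hx, y, -, rfl⟩ := ho
      exact hsome x (by simpa using hx) y
    rw [mean_const] at h1
    set q := perturbProb lam n
    have hq := perturbProb_le (n := n) hlam
    have h2 := mul_le_mul_of_nonneg_left h1 q.2.1
    have h3 := mul_le_mul_of_nonneg_left hnone (sub_nonneg.mpr q.2.2)
    have h4 := mul_le_mul_of_nonneg_right hq hK
    linarith
  · rw [mean_pure]
    linarith

theorem mean_slotLaw (p : I) (lam : ℝ) (S : Config n)
    (f : Finset (ZMod n) × Option (ZMod n × ZMod n) → ℝ) :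
    mean (slotLaw p lam S) f
      = mean (movers p S) fun M => mean (perturbation lam (moved S M)) fun o => f (M, o) := by
  rw [slotLaw, mean_bind]
  simp only [mean_map, Function.comp_def]

theorem mean_lyapunov_slot_le (p : I) {lam : ℝ} (hlam : 0 ≤ lam) (hα : 0 < α) (hα1 : α ≤ 1)
    (hh : h = (p : ℝ) / (1 + p)) (hε : 0 < ε) (hE : ∀ z, Summable (expHeight α h S z)) :
    mean (slotLaw p lam S) (fun o => lyapunov α h ε (applyPerturbation (moved S o.1) o.2))
      ≤ lyapunov α h ε S + n * (α ^ 2 + 4 * ε) - α * ((clusterSites S).card / 2)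
        + lam * (α + Real.log (1 + 1 / ε)) := by
  have hn : (0 : ℝ) < n := by exact_mod_cast NeZero.pos n
  have hlog : 0 ≤ Real.log (1 + 1 / ε) :=
    Real.log_nonneg (le_add_of_nonneg_right (by positivity))
  rw [mean_slotLaw]
  have h1 : mean (movers p S) (fun M => mean (perturbation lam (moved S M)) fun o =>
      lyapunov α h ε (applyPerturbation (moved S M) o))
      ≤ mean (movers p S) fun M => lyapunov α h ε (moved S M)
        + lam * (α + Real.log (1 + 1 / ε)) := by
    refine mean_mono _ fun M hM => ?_
    have hM' := isMove_of_mem_support hM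
    have hE' : ∀ z, Summable (expHeight α h (moved S M) z) := fun z => by
      simpa using summable_moved hα.le hM' (hE (z - 1))
    refine (mean_perturbation_le hlam (moved S M) (c := lyapunov α h ε (moved S M))
      (K := n * (α + Real.log (1 + 1 / ε))) (by positivity) le_rfl
      fun x hx y => lyapunov_relocate_le hα.le hε hE' hx y).trans (le_of_eq ?_)
    field_simp
  rw [mean_add, mean_const] at h1
  linarith [mean_lyapunov_moved_le p hα hα1 hh hε hE]

/-- In a stationary regime, the mean number of clustered particles is small. -/
theorem IsStationary.mean_card_clusterSites_le {p : I} {lam : ℝ} {k : ℕ} {μ : PMF (State n)}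
    (hμ : IsStationary p lam k μ) (hlam : 0 ≤ lam) (hk : (k : ℝ) < (p : ℝ) / (1 + p) * n)
    (hα : 0 < α) (hα1 : α ≤ 1) :
    mean μ (fun s => ((clusterSites s.1).card : ℝ) / n)
      ≤ 10 * α + 2 * lam * (α + Real.log (1 + 1 / α ^ 2)) / α * (n : ℝ)⁻¹ := by
  have hn : (0 : ℝ) < n := by exact_mod_cast NeZero.pos n
  have hp0 : (0 : ℝ) ≤ p := p.2.1
  set h := (p : ℝ) / (1 + p) with hh
  have hh0 : 0 ≤ h := by positivity
  have hε : 0 < α ^ 2 := by positivity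
  set V := fun s : State n => lyapunov α h (α ^ 2) s.1 with hV
  have h1 : mean μ V ≤ mean μ fun s => V s
      + (n * (α ^ 2 + 4 * α ^ 2) + lam * (α + Real.log (1 + 1 / α ^ 2)))
      - (α * n / 2) * ((clusterSites s.1).card / n) := by
    -- Stationarity: only the left side is advanced by one time slot.
    conv_lhs => rw [← hμ.bind_step, mean_bind]
    refine mean_mono _ fun s hs => ?_
    have hE : ∀ z, Summable (expHeight α h s.1 z) :=
      summable_exp_height hα hh0 (by rw [hμ.card_eq s hs]; exact hk)
    have h2 := mean_lyapunov_slot_le p hlam hα hα1 hh hε hE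
    rw [step, mean_map]
    have h3 : (α * n / 2) * (((clusterSites s.1).card : ℝ) / n)
        = α * ((clusterSites s.1).card / 2) := by field_simp
    rw [h3]
    simp only [hV, Function.comp_def]
    linarith
  rw [mean_sub, mean_add, mean_const, mean_const_mul] at h1
  -- With `ε = α²` both drift errors are of order `α²`, and dividing by the gain `α / 2` gives `10
  -- α`.
  have h4 : α * n / 2 * (10 * α + 2 * lam * (α + Real.log (1 + 1 / α ^ 2)) / α * (n : ℝ)⁻¹)
      = n * (α ^ 2 + 4 * α ^ 2) + lam * (α + Real.log (1 + 1 / α ^ 2)) := by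
    field_simp
    ring
  refine le_of_mul_le_mul_left (a := α * n / 2) ?_ (by positivity)
  linarith

end Drift

/-! ### Cluster length, flux and laws in terms of clustered particles -/

section Descriptors

variable {n : ℕ} [NeZero n] {S M : Finset (ZMod n)}

theorem clusterLength_nonneg (S : Config n) : 0 ≤ clusterLength S := by
  unfold clusterLength; positivity

theorem clusterLength_le (S : Config n) : clusterLength S ≤ ((clusterSites S).card : ℝ) / n := by
  unfold clusterLength
  gcongr
  exact Nat.sub_le _ _

theorem instantFlux_eq (p : I) (lam : ℝ) (S : Config n) :
    instantFlux p lam S = mean (slotLaw p lam S) (fun o => (distance o : ℝ)) / n := rfl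

/-- A relocation covers less than `n` sites and has probability at most `lam / n`, so it adds at
most `lam` to the mean distance. -/
theorem instantFlux_le (p : I) {lam : ℝ} (hlam : 0 ≤ lam) (S : Config n) :
    instantFlux p lam S ≤ S.card / n + lam * (n : ℝ)⁻¹ := by
  have hn : (0 : ℝ) < n := by exact_mod_cast NeZero.pos n
  rw [instantFlux_eq, div_le_iff₀ hn, mean_slotLaw]
  have h1 : mean (movers p S) (fun M => mean (perturbation lam (moved S M)) fun o =>
      (distance (M, o) : ℝ)) ≤ mean (movers p S) fun _ => (S.card : ℝ) + lam / n * n := by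
    refine mean_mono _ fun M hM => ?_
    have hM' : (M.card : ℝ) ≤ S.card := by
      exact_mod_cast Finset.card_le_card fun j hj => ((isMove_of_mem_support hM).mem hj).1
    refine mean_perturbation_le hlam _ hn.le (by simpa [distance] using hM') fun x _ y => ?_
    have h2 : ((y - x).val : ℝ) ≤ n := by exact_mod_cast (ZMod.val_lt (y - x)).le
    simp only [distance, Nat.cast_add]
    linarith
  rw [mean_const] at h1
  refine h1.trans (le_of_eq ?_)
  field_simp

/-- Only clustered particles can fail to move, and relocations travel a nonnegative distance. -/
theorem le_instantFlux (p : I) (lam : ℝ) (S : Config n) :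
    S.card / n - ((clusterSites S).card : ℝ) / n ≤ instantFlux p lam S := by
  have hn : (0 : ℝ) < n := by exact_mod_cast NeZero.pos n
  rw [instantFlux_eq, ← sub_div, div_le_div_iff_of_pos_right hn, mean_slotLaw]
  rw [← mean_const (movers p S) ((S.card : ℝ) - (clusterSites S).card)]
  refine mean_mono _ fun M hM => ?_
  have hM' := isMove_of_mem_support hM
  rw [← mean_const (perturbation lam (moved S M)) ((S.card : ℝ) - (clusterSites S).card)]
  refine mean_mono _ fun o _ => ?_
  have h1 := card_sdiff_le_card_clusterSites hM'
  have h2 : S.card ≤ (S \ M).card + M.card := Finset.card_le_card_sdiff_add_card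
  have h3 : (S.card : ℝ) ≤ (clusterSites S).card + M.card := by exact_mod_cast by omega
  simp only [distance, Nat.cast_add]
  have h4 : (0 : ℝ) ≤ ((match o with
    | none => 0
    | some (x, y) => (y - x).val : ℕ) : ℝ) := Nat.cast_nonneg _
  linarith

theorem IsStationary.abs_flux_sub_le {p : I} {lam : ℝ} {k : ℕ} {μ : PMF (State n)}
    (hμ : IsStationary p lam k μ) (hlam : 0 ≤ lam) :
    |flux p lam μ - (k : ℝ) / n|
      ≤ mean μ (fun s => ((clusterSites s.1).card : ℝ) / n) + lam * (n : ℝ)⁻¹ := by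
  have h0 : 0 ≤ mean μ (fun s => ((clusterSites s.1).card : ℝ) / n) :=
    Finset.sum_nonneg fun s _ => by positivity
  have h1 : 0 ≤ lam * (n : ℝ)⁻¹ := by positivity
  have h2 : flux p lam μ = mean μ fun s => instantFlux p lam s.1 := rfl
  have h3 := mean_mono μ (f := fun s => instantFlux p lam s.1)
    (g := fun _ => (k : ℝ) / n + lam * (n : ℝ)⁻¹) fun s hs => by
      rw [← hμ.card_eq s hs]
      exact instantFlux_le p hlam s.1
  have h4 := mean_mono μ (g := fun s => instantFlux p lam s.1)
    (f := fun s => (k : ℝ) / n - ((clusterSites s.1).card : ℝ) / n) fun s hs => by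
      rw [← hμ.card_eq s hs]
      exact le_instantFlux p lam s.1
  rw [mean_const] at h3
  rw [mean_sub, mean_const] at h4
  rw [abs_le, h2]
  constructor <;> linarith

theorem integral_lengthLaw (μ : PMF (State n)) (f : BoundedContinuousFunction ℝ ℝ) :
    ∫ x, f x ∂(lengthLaw μ : Measure ℝ) = mean μ fun s => f (clusterLength s.1) := by
  -- The discrete σ-algebra makes every function of the state measurable.
  let _ : MeasurableSpace (State n) := ⊤
  have : DiscreteMeasurableSpace (State n) := ⟨fun _ => trivial⟩
  have h1 : (lengthLaw μ : Measure ℝ)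
      = μ.toMeasure.map fun s : State n => clusterLength s.1 :=
    (PMF.toMeasure_map (p := μ) _ (measurable_of_countable _)).symm
  rw [h1, integral_map (measurable_of_countable _).aemeasurable
    f.continuous.aestronglyMeasurable, PMF.integral_eq_sum]
  rfl

theorem map_tau_scaledLaw (μ : PMF (State n)) (hm : Measurable ScaledState.tau) :
    (scaledLaw μ).map hm.aemeasurable = lengthLaw μ := by
  refine Subtype.ext ?_
  have h1 : ((μ.map scaledState).map ScaledState.tau).toMeasure
      = (μ.map scaledState).toMeasure.map ScaledState.tau :=
    (PMF.toMeasure_map (p := μ.map scaledState) _ hm).symm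
  rw [PMF.map_comp] at h1
  exact h1.symm

end Descriptors

theorem continuous_tau : Continuous ScaledState.tau :=
  (continuous_snd.comp (continuous_snd.comp continuous_snd) :
    Continuous fun s : (Set.Ico (0 : ℝ) 1 →ᵤ ℝ) × UnitAddCircle × UnitAddCircle × ℝ => s.2.2.2)

theorem tendsto_pnat_coe : Tendsto (fun n : ℕ+ => ((n : ℕ) : ℝ)) atTop atTop :=
  tendsto_natCast_atTop_atTop.comp tendsto_PNat_val_atTop_atTop

/-! ### Passage to the limit -/

section Limits

variable {p : I} {lam rho : ℝ} {μ : ∀ n : ℕ+, PMF (State n)}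

theorem tendsto_mean_card_clusterSites (hlam : 0 ≤ lam) (hrho : 0 ≤ rho)
    (hrho_lt : rho < (p : ℝ) / (1 + p))
    (hμ : ∀ᶠ n : ℕ+ in atTop, IsStationary p lam ⌈rho * (n : ℕ)⌉₊ (μ n)) :
    Tendsto (fun n : ℕ+ => mean (μ n) fun s => ((clusterSites s.1).card : ℝ) / (n : ℕ)) atTop
      (𝓝 0) := by
  rw [tendsto_order]
  refine ⟨fun a ha => Eventually.of_forall fun _ => ha.trans_le
    (Finset.sum_nonneg fun s _ => by positivity), fun a ha => ?_⟩
  -- This makes `10 α ≤ a / 2`, leaving room for the term that vanishes as `n → ∞`.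
  set α := min 1 (a / 20) with hα
  have hα0 : 0 < α := lt_min one_pos (by positivity)
  have hαa : α ≤ a / 20 := min_le_right _ _
  have hlim : Tendsto (fun n : ℕ+ => 10 * α
      + 2 * lam * (α + Real.log (1 + 1 / α ^ 2)) / α * ((n : ℕ) : ℝ)⁻¹) atTop
      (𝓝 (10 * α + 2 * lam * (α + Real.log (1 + 1 / α ^ 2)) / α * 0)) :=
    ((tendsto_inv_atTop_zero.comp tendsto_pnat_coe).const_mul _).const_add _
  -- The rounding in `⌈rho * n⌉₊` adds less than one particle, and the gap to the critical density
  -- absorbs it for such `n`.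
  have hlarge : ∀ᶠ n : ℕ+ in atTop, ((p : ℝ) / (1 + p) - rho)⁻¹ < ((n : ℕ) : ℝ) :=
    tendsto_pnat_coe.eventually_gt_atTop _
  filter_upwards [hμ, hlarge, hlim.eventually_lt_const (u := a) (by linarith)] with n h1 h2 h3
  refine (h1.mean_card_clusterSites_le hlam ?_ hα0 (min_le_left _ _)).trans_lt h3
  have h4 := Nat.ceil_lt_add_one (a := rho * (n : ℕ)) (by positivity)
  rw [inv_lt_iff_one_lt_mul₀ (sub_pos.mpr hrho_lt)] at h2
  linarith

theorem tendsto_meanLength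
    (hμ : Tendsto (fun n : ℕ+ => mean (μ n) fun s => ((clusterSites s.1).card : ℝ) / (n : ℕ))
      atTop (𝓝 0)) :
    Tendsto (fun n : ℕ+ => meanLength (μ n)) atTop (𝓝 0) :=
  squeeze_zero
    (fun _ => Finset.sum_nonneg fun s _ =>
      mul_nonneg ENNReal.toReal_nonneg (clusterLength_nonneg s.1))
    (fun n => mean_mono (μ n) fun s _ => clusterLength_le s.1) hμ

theorem tendsto_lengthLaw (hμ : Tendsto (fun n : ℕ+ => meanLength (μ n)) atTop (𝓝 0)) :
    Tendsto (fun n : ℕ+ => lengthLaw (μ n)) atTop (𝓝 (diracProba (0 : ℝ))) := by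
  rw [ProbabilityMeasure.tendsto_iff_forall_integral_tendsto]
  intro f
  simp only [integral_lengthLaw]
  have h0 : ∫ x, f x ∂(diracProba (0 : ℝ) : Measure ℝ) = f 0 := by
    simp [diracProba]
  rw [h0, Metric.tendsto_nhds]
  intro ε hε
  obtain ⟨δ, hδ, hf⟩ := Metric.continuousAt_iff.mp (f.continuous.continuousAt (x := 0))
    (ε / 2) (by positivity)
  have hlim := (hμ.const_mul (2 * ‖f‖ / δ)).const_add (ε / 2)
  filter_upwards [hlim.eventually_lt_const (u := ε) (by linarith)] with n hn
  refine lt_of_le_of_lt ?_ hn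
  -- Markov's inequality in pointwise form: continuity at 0 handles lengths below `δ`, and
  -- boundedness the others.
  have key : ∀ s : State n, |f (clusterLength s.1) - f 0|
      ≤ ε / 2 + 2 * ‖f‖ / δ * clusterLength s.1 := fun s => by
    have hτ := clusterLength_nonneg s.1
    rcases lt_or_ge (clusterLength s.1) δ with h | h
    · have h1 := hf (x := clusterLength s.1) (by rwa [Real.dist_eq, sub_zero, abs_of_nonneg hτ])
      rw [Real.dist_eq] at h1
      have : 0 ≤ 2 * ‖f‖ / δ * clusterLength s.1 := by positivity
      linarith
    · have h1 : |f (clusterLength s.1) - f 0| ≤ 2 * ‖f‖ := by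
        simpa [Real.dist_eq] using f.dist_le_two_norm (clusterLength s.1) 0
      have h2 : 2 * ‖f‖ ≤ 2 * ‖f‖ / δ * clusterLength s.1 := by
        rw [div_mul_eq_mul_div, le_div_iff₀ hδ]
        gcongr
      linarith
  have up := mean_mono (μ n) fun s _ => (abs_le.mp (key s)).2
  have lo := mean_mono (μ n) (f := fun s => f 0 - (ε / 2 + 2 * ‖f‖ / δ * clusterLength s.1))
    (g := fun s => f (clusterLength s.1)) fun s _ => by linarith [(abs_le.mp (key s)).1]
  rw [mean_sub, mean_add, mean_const, mean_const, mean_const_mul] at up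
  rw [mean_sub, mean_add, mean_const, mean_const, mean_const_mul] at lo
  have hmean : meanLength (μ n) = mean (μ n) fun s => clusterLength s.1 := rfl
  rw [Real.dist_eq, abs_le, hmean]
  constructor <;> linarith

/-- The continuous mapping theorem for `τ`, with uniqueness of weak limits on `ℝ`, forces the law of
`τ` under `ν` to be the point mass at 0. -/
theorem ae_tau_eq_zero
    (hμ : Tendsto (fun n : ℕ+ => lengthLaw (μ n)) atTop (𝓝 (diracProba (0 : ℝ))))
    {φ : ℕ → ℕ+} {ν : ProbabilityMeasure ScaledState} (hφ : StrictMono φ)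
    (hν : Tendsto (fun j => scaledLaw (μ (φ j))) atTop (𝓝 ν)) :
    ∀ᵐ s ∂(ν : Measure ScaledState), s.tau = 0 := by
  have hm : Measurable ScaledState.tau := continuous_tau.measurable
  have hφ' : Tendsto φ atTop atTop := tendsto_atTop_atTop.mpr fun b => ⟨b, fun a ha =>
    PNat.coe_le_coe _ _ |>.mp <| ha.trans <|
      StrictMono.le_apply (f := fun j => (φ j : ℕ)) fun _ _ hij => hφ hij⟩
  have h1 := ProbabilityMeasure.tendsto_map_of_tendsto_of_continuous _ _ hν continuous_tau
  simp only [fun j => map_tau_scaledLaw (μ (φ j)) hm] at h1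
  have h2 := tendsto_nhds_unique h1 (hμ.comp hφ')
  have h3 : (ν : Measure ScaledState).map ScaledState.tau = Measure.dirac 0 :=
    congrArg Subtype.val h2
  have h4 : ∀ᵐ x ∂((ν : Measure ScaledState).map ScaledState.tau), x = 0 := by
    rw [h3, ae_dirac_eq]
    exact Filter.eventually_pure.mpr rfl
  exact ae_of_ae_map hm.aemeasurable h4

theorem tendsto_flux (hlam : 0 ≤ lam) (hrho : 0 ≤ rho)
    (hst : ∀ᶠ n : ℕ+ in atTop, IsStationary p lam ⌈rho * (n : ℕ)⌉₊ (μ n))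
    (hμ : Tendsto (fun n : ℕ+ => mean (μ n) fun s => ((clusterSites s.1).card : ℝ) / (n : ℕ))
      atTop (𝓝 0)) :
    Tendsto (fun n : ℕ+ => flux p lam (μ n)) atTop (𝓝 rho) := by
  have hinv := tendsto_inv_atTop_zero.comp tendsto_pnat_coe
  have h1 : Tendsto (fun n : ℕ+ => flux p lam (μ n) - (⌈rho * (n : ℕ)⌉₊ : ℝ) / (n : ℕ)) atTop
      (𝓝 0) := by
    have hb := hμ.add (hinv.const_mul lam)
    rw [mul_zero, add_zero] at hb
    exact squeeze_zero_norm' (hst.mono fun n h => h.abs_flux_sub_le hlam) hb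
  have h2 : Tendsto (fun n : ℕ+ => (⌈rho * (n : ℕ)⌉₊ : ℝ) / (n : ℕ)) atTop (𝓝 rho) :=
    (tendsto_nat_ceil_mul_div_atTop hrho).comp tendsto_pnat_coe
  simpa using h1.add h2

end Limits

end

end TASEPH

theorem mainTheorem2 (p : unitInterval) (hp : 0 < (p : ℝ)) (lam : ℝ) (hlam : 0 < lam)
    (rho : ℝ) (hrho : 0 < rho) (hrho_lt : rho < (p : ℝ) / (1 + (p : ℝ)))
    (μ : ∀ n : ℕ+, PMF (TASEPH.State n))
    (hμ : ∀ᶠ n : ℕ+ in atTop, TASEPH.IsStationary p lam ⌈rho * (n : ℕ)⌉₊ (μ n)) :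
    (∀ (φ : ℕ → ℕ+) (ν : ProbabilityMeasure TASEPH.ScaledState), StrictMono φ →
      Tendsto (fun j => TASEPH.scaledLaw (μ (φ j))) atTop (𝓝 ν) →
      ∀ᵐ s ∂(ν : Measure TASEPH.ScaledState), s.tau = 0) ∧
    Tendsto (fun n : ℕ+ => TASEPH.lengthLaw (μ n)) atTop (𝓝 (diracProba (0 : ℝ))) ∧
    Tendsto (fun n : ℕ+ => TASEPH.meanLength (μ n)) atTop (𝓝 0) ∧
    Tendsto (fun n : ℕ+ => TASEPH.flux p lam (μ n)) atTop (𝓝 rho) := by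
  have h1 := TASEPH.tendsto_mean_card_clusterSites hlam.le hrho.le hrho_lt hμ
  have h2 := TASEPH.tendsto_meanLength h1
  have h3 := TASEPH.tendsto_lengthLaw h2
  exact ⟨fun φ ν hφ hν => TASEPH.ae_tau_eq_zero h3 hφ hν, h3, h2,
    TASEPH.tendsto_flux hlam.le hrho.le hμ h1⟩
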